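/- Let $\mu$ be a nontrivial probability measure on the unit circle $\mathbb T=\{z\in\mathbb C:|z|=1\}$ (nontrivial: its support is infinite). Let $\phi_n$ $(n\ge 0)$ be its monic orthogonal polynomials, i.e. $\phi_n$ is monic of degree $n$ and $\int_{\mathbb T}\bar z^{\,j}\phi_n(z)\,d\mu(z)=0$ for $0\le j\le n-1$, and let $\alpha_n=-\overline{\phi_{n+1}(0)}$, $n\ge 0$, be its Verblunsky coefficients. Put $\tau_0=1$ and $\tau_n=\tau_{n-1}\dfrac{1-\overline{\tau_{n-1}\alpha_{n-1}}}{1-\tau_{n-1}\alpha_{n-1}}$ for $n\ge 1$. A real sequence $\{d_n\}_{n=1}^\infty$ is a positive chain sequence if there is a parameter sequence $\{g_n\}_{n=0}^\infty$ with $0\le g_0<1$, $0<g_n<1$ and $d_n=(1-g_{n-1})g_n$ for $n\ge 1$; its minimal parameter sequence $\{m_n\}_{n=0}^\infty$ is the parameter sequence with $m_0=0$. The pair of real sequences $\{\{c_n\}_{n=1}^\infty,\{d_n\}_{n=1}^\infty\}$ is associated with $\mu$ if $\{d_n\}$ is a positive chain sequence and, with $\{m_n\}_{n=0}^\infty$ its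 minimal parameter sequence, $$c_n=\frac{-\operatorname{Im}(\tau_{n-1}\alpha_{n-1})}{1-\operatorname{Re}(\tau_{n-1}\alpha_{n-1})},\qquad m_n=\frac12\,\frac{|1-\tau_{n-1}\alpha_{n-1}|^2}{1-\operatorname{Re}(\tau_{n-1}\alpha_{n-1})},\qquad n\ge 1.$$ Let $\{\{c_n\},\{d_n\}\}$ be the pair associated with $\mu$, let $\{m_n\}_{n=0}^\infty$ be the minimal parameter sequence of $\{d_n\}$, and let $p\ge 1$ be an integer such that $c_{n+p}=c_n$ and $m_{n+p}=m_n$ for all $n\ge 1$. Suppose also that $c_{2n}=-c_{2n-1}$ for all $n\ge 1$. Then: (i) if $p$ is even, the Verblunsky coefficients of $\mu$ are $p$-periodic, i.e. $\alpha_{n+p}=\alpha_n$ for all $n\ge 0$; (ii) if $p$ is odd, then $\mu$ is symmetric, i.e. invariant under $z\mapsto 1/z=\bar z$, moreover $c_n=0$ for all $n\ge 1$, and $\alpha_{n+p}=\alpha_n$ for all $n\ge 0$. -/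

import Mathlib

open MeasureTheory Polynomial

namespace OPUC

noncomputable section

/-- The unit circle carries its Borel sigma-algebra. -/
instance instMeasurableSpaceCircle : MeasurableSpace Circle := borel Circle

instance instBorelSpaceCircle : BorelSpace Circle := ⟨rfl⟩

/-- A measure on the unit circle is nontrivial if it is not carried by finitely many points,
i.e. if its support is infinite. -/
def IsNontrivial (μ : Measure Circle) : Prop :=
  ∀ s : Set Circle, s.Finite → μ sᶜ ≠ 0

/-- The (semi-)inner product `∫ conj (P z) * Q z dμ(z)` on polynomials. -/
def innerProd (μ : Measure Circle) (P Q : ℂ[X]) : ℂ :=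
  ∫ z : Circle, (starRingEnd ℂ) (P.eval (z : ℂ)) * Q.eval (z : ℂ) ∂μ

/-- The monic orthogonal polynomials on the unit circle, by the Gram-Schmidt process applied to
`1, z, z ^ 2, …`. See `monicOPUC_monic`, `natDegree_monicOPUC`, `integral_monicOPUC` and
`eq_monicOPUC` for the fact that, for a nontrivial probability measure, these are the unique
monic polynomials of degree `n` orthogonal to `1, z, …, z ^ (n - 1)`. -/
def monicOPUC (μ : Measure Circle) (n : ℕ) : ℂ[X] :=
  X ^ n - ∑ k : Fin n,
    C (innerProd μ (monicOPUC μ k) (X ^ n) /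
      innerProd μ (monicOPUC μ k) (monicOPUC μ k)) * monicOPUC μ k
termination_by n
decreasing_by all_goals exact k.isLt

/-- The Verblunsky coefficients `α n = - conj (φ (n + 1) 0)`, for `n ≥ 0`. -/
def verblunsky (μ : Measure Circle) (n : ℕ) : ℂ :=
  -(starRingEnd ℂ) ((monicOPUC μ (n + 1)).eval 0)

/-- `τ 0 = 1` and
`τ n = τ (n - 1) * (1 - conj (τ (n - 1) * α (n - 1))) / (1 - τ (n - 1) * α (n - 1))`. -/
def tau (α : ℕ → ℂ) : ℕ → ℂ
  | 0 => 1
  | n + 1 => tau α n *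
      ((1 - (starRingEnd ℂ) (tau α n) * (starRingEnd ℂ) (α n)) / (1 - tau α n * α n))

/-- `g = (g 0, g 1, …)` is a parameter sequence of `d = (d 1, d 2, …)`.
The value `d 0` plays no role. -/
structure IsParameterSeq (d g : ℕ → ℝ) : Prop where
  zero_nonneg : 0 ≤ g 0
  zero_lt_one : g 0 < 1
  pos : ∀ n, 1 ≤ n → 0 < g n
  lt_one : ∀ n, 1 ≤ n → g n < 1
  eq_mul : ∀ n, 1 ≤ n → d n = (1 - g (n - 1)) * g n

/-- `d = (d 1, d 2, …)` is a positive chain sequence. -/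
def IsPositiveChainSeq (d : ℕ → ℝ) : Prop :=
  ∃ g : ℕ → ℝ, IsParameterSeq d g

/-- `m` is the minimal parameter sequence of the positive chain sequence `d`: the parameter
sequence that starts with `m 0 = 0`. -/
structure IsMinimalParameterSeq (d m : ℕ → ℝ) : Prop extends IsParameterSeq d m where
  zero_eq : m 0 = 0

/-- `c = (c 1, c 2, …)` and `d = (d 1, d 2, …)` form the pair of real sequences associated with
the measure `μ`: `d` is a positive chain sequence and, with `m` its minimal parameter sequence,
`c` and `m` are given by the Verblunsky coefficients of `μ`.
The values `c 0` and `d 0` play no role. -/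
def IsAssociatedPair (μ : Measure Circle) (c d : ℕ → ℝ) : Prop :=
  ∃ m : ℕ → ℝ, IsMinimalParameterSeq d m ∧
    ∀ n, 1 ≤ n →
      c n = -(tau (verblunsky μ) (n - 1) * verblunsky μ (n - 1)).im /
          (1 - (tau (verblunsky μ) (n - 1) * verblunsky μ (n - 1)).re) ∧
      m n = 1 / 2 * (‖1 - tau (verblunsky μ) (n - 1) * verblunsky μ (n - 1)‖ ^ 2 /
          (1 - (tau (verblunsky μ) (n - 1) * verblunsky μ (n - 1)).re))

/-- Symmetry of `μ`: invariance under `z ↦ 1 / z`, i.e. under complex conjugation. -/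
def IsSymmetric (μ : Measure Circle) : Prop :=
  μ.map (fun z : Circle => z⁻¹) = μ

/-! The polynomials `monicOPUC μ n` are the monic orthogonal polynomials. -/

theorem continuous_innerProd_aux (P Q : ℂ[X]) :
    Continuous fun z : Circle => (starRingEnd ℂ) (P.eval (z : ℂ)) * Q.eval (z : ℂ) := by
  have hc : Continuous fun z : Circle => (z : ℂ) := continuous_subtype_val
  exact (Complex.continuous_conj.comp (P.continuous.comp hc)).mul (Q.continuous.comp hc)

theorem integrable_innerProd (μ : Measure Circle) [IsProbabilityMeasure μ] (P Q : ℂ[X]) :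
    Integrable (fun z : Circle => (starRingEnd ℂ) (P.eval (z : ℂ)) * Q.eval (z : ℂ)) μ :=
  (continuous_innerProd_aux P Q).integrable_of_hasCompactSupport
    (HasCompactSupport.of_compactSpace _)

theorem innerProd_sub (μ : Measure Circle) [IsProbabilityMeasure μ] (P Q R : ℂ[X]) :
    innerProd μ P (Q - R) = innerProd μ P Q - innerProd μ P R := by
  simp only [innerProd, eval_sub, mul_sub]
  exact integral_sub (integrable_innerProd μ P Q) (integrable_innerProd μ P R)

theorem innerProd_C_mul (μ : Measure Circle) (P Q : ℂ[X]) (a : ℂ) :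
    innerProd μ P (C a * Q) = a * innerProd μ P Q := by
  simp only [innerProd, eval_mul, eval_C]
  rw [← integral_const_mul]
  congr 1
  ext z
  ring

theorem innerProd_sum (μ : Measure Circle) [IsProbabilityMeasure μ] {ι : Type*} (s : Finset ι)
    (P : ℂ[X]) (Q : ι → ℂ[X]) :
    innerProd μ P (∑ i ∈ s, Q i) = ∑ i ∈ s, innerProd μ P (Q i) := by
  simp only [innerProd, eval_finsetSum, Finset.mul_sum]
  exact integral_finsetSum s fun i _ => integrable_innerProd μ P (Q i)

theorem innerProd_conj (μ : Measure Circle) (P Q : ℂ[X]) :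
    (starRingEnd ℂ) (innerProd μ P Q) = innerProd μ Q P := by
  simp only [innerProd]
  rw [← integral_conj]
  congr 1
  ext z
  simp [mul_comm]

theorem innerProd_self_ne_zero {μ : Measure Circle} [IsProbabilityMeasure μ]
    (hμ : IsNontrivial μ) {P : ℂ[X]} (hP : P ≠ 0) : innerProd μ P P ≠ 0 := by
  intro h
  have h1 : ∀ z : Circle, (starRingEnd ℂ) (P.eval (z : ℂ)) * P.eval (z : ℂ) =
      ((‖P.eval (z : ℂ)‖ ^ 2 : ℝ) : ℂ) := fun z => by
    rw [Complex.conj_mul']; push_cast; rfl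
  simp only [innerProd, h1] at h
  rw [integral_complex_ofReal, Complex.ofReal_eq_zero] at h
  have hint : Integrable (fun z : Circle => ‖P.eval (z : ℂ)‖ ^ 2) μ := by
    have := (integrable_innerProd μ P P).norm
    refine this.congr (Filter.Eventually.of_forall fun z => ?_)
    simp [sq]
  rw [integral_eq_zero_iff_of_nonneg (fun z => by positivity) hint] at h
  have hfin : {z : Circle | P.eval (z : ℂ) = 0}.Finite := by
    have : ((fun z : Circle => (z : ℂ)) ⁻¹' (P.rootSet ℂ)).Finite :=
      (P.rootSet_finite ℂ).preimage (Subtype.val_injective.injOn)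
    refine this.subset fun z hz => ?_
    simp only [Set.mem_preimage, mem_rootSet]
    exact ⟨hP, by simpa using hz⟩
  refine hμ _ hfin ?_
  have h2 := ae_iff.1 h
  convert h2 using 2
  ext z
  simp

theorem monicOPUC_monic_natDegree (μ : Measure Circle) (n : ℕ) :
    (monicOPUC μ n).Monic ∧ (monicOPUC μ n).natDegree = n := by
  induction n using Nat.strong_induction_on with
  | _ n ih =>
    have hlt : (∑ k : Fin n,
        C (innerProd μ (monicOPUC μ k) (X ^ n) /
          innerProd μ (monicOPUC μ k) (monicOPUC μ k)) * monicOPUC μ k).degree < (n : ℕ) := by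
      refine lt_of_le_of_lt (degree_sum_le _ _) ?_
      refine (Finset.sup_lt_iff (WithBot.bot_lt_coe n)).2 fun k _ => ?_
      rw [← smul_eq_C_mul]
      refine lt_of_le_of_lt (degree_smul_le _ _) ?_
      rw [degree_eq_natDegree (ih k k.isLt).1.ne_zero, (ih k k.isLt).2]
      exact Nat.cast_lt.2 k.isLt
    rw [monicOPUC]
    refine ⟨(monic_X_pow n).sub_of_left (by simpa using hlt), ?_⟩
    apply natDegree_eq_of_degree_eq_some
    rw [degree_sub_eq_left_of_degree_lt (by simpa using hlt), degree_X_pow]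

theorem monicOPUC_monic (μ : Measure Circle) (n : ℕ) : (monicOPUC μ n).Monic :=
  (monicOPUC_monic_natDegree μ n).1

theorem natDegree_monicOPUC (μ : Measure Circle) (n : ℕ) : (monicOPUC μ n).natDegree = n :=
  (monicOPUC_monic_natDegree μ n).2

theorem innerProd_monicOPUC_of_lt {μ : Measure Circle} [IsProbabilityMeasure μ]
    (hμ : IsNontrivial μ) (n : ℕ) :
    ∀ j, j < n → innerProd μ (monicOPUC μ j) (monicOPUC μ n) = 0 := by
  induction n using Nat.strong_induction_on with
  | _ n ih =>
    intro j hj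
    have key : ∀ k : Fin n, k ≠ ⟨j, hj⟩ →
        innerProd μ (monicOPUC μ j) (C (innerProd μ (monicOPUC μ k) (X ^ n) /
          innerProd μ (monicOPUC μ k) (monicOPUC μ k)) * monicOPUC μ k) = 0 := by
      intro k hk
      rw [innerProd_C_mul]
      rcases lt_trichotomy (k : ℕ) j with h | h | h
      · rw [← innerProd_conj μ (monicOPUC μ k) (monicOPUC μ j), ih j hj k h]; simp
      · exact absurd (Fin.ext h) hk
      · rw [ih k k.isLt j h, mul_zero]
    rw [monicOPUC.eq_1 μ n, innerProd_sub, innerProd_sum,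
      Finset.sum_eq_single (⟨j, hj⟩ : Fin n) (fun k _ hk => key k hk) (by simp),
      innerProd_C_mul, div_mul_cancel₀ _ (innerProd_self_ne_zero hμ (monicOPUC_monic μ j).ne_zero),
      sub_self]

theorem innerProd_monicOPUC_of_degree_lt {μ : Measure Circle} [IsProbabilityMeasure μ]
    (hμ : IsNontrivial μ) (n : ℕ) (j : ℕ) :
    ∀ Q : ℂ[X], Q.degree < (j : ℕ) → j ≤ n → innerProd μ (monicOPUC μ n) Q = 0 := by
  induction j with
  | zero =>
    intro Q hQ _
    have : Q = 0 := by
      rw [← degree_eq_bot]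
      exact Nat.WithBot.lt_zero_iff.1 (by simpa using hQ)
    simp [this, innerProd]
  | succ j ih =>
    intro Q hQ hj
    have hdec : Q = (Q - C (Q.coeff j) * monicOPUC μ j) + C (Q.coeff j) * monicOPUC μ j := by ring
    have hd : (Q - C (Q.coeff j) * monicOPUC μ j).degree < (j : ℕ) := by
      rw [degree_lt_iff_coeff_zero]
      intro i hi
      rcases hi.eq_or_lt with h | h
      · subst h
        have := (monicOPUC_monic μ j).coeff_natDegree
        rw [natDegree_monicOPUC] at this
        simp [this]
      · have h1 : Q.coeff i = 0 := (degree_lt_iff_coeff_zero _ _).1 hQ i h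
        have h2 : (monicOPUC μ j).coeff i = 0 :=
          coeff_eq_zero_of_natDegree_lt (by rw [natDegree_monicOPUC]; exact h)
        simp [h1, h2]
    have h0 := ih _ hd (by omega)
    rw [innerProd_sub, innerProd_C_mul, ← innerProd_conj μ (monicOPUC μ j),
      innerProd_monicOPUC_of_lt hμ n j (by omega)] at h0
    simpa using h0

/-- Orthogonality: `∫ conj z ^ j * φ n z dμ = 0` for `0 ≤ j ≤ n - 1`. -/
theorem integral_monicOPUC {μ : Measure Circle} [IsProbabilityMeasure μ]
    (hμ : IsNontrivial μ) {n j : ℕ} (hj : j < n) :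
    ∫ z : Circle, (starRingEnd ℂ) (z : ℂ) ^ j * (monicOPUC μ n).eval (z : ℂ) ∂μ = 0 := by
  have h := innerProd_monicOPUC_of_degree_lt hμ n n (X ^ j)
    (by rw [degree_X_pow]; exact_mod_cast hj) le_rfl
  rw [← innerProd_conj, map_eq_zero] at h
  simpa [innerProd] using h

/-- Uniqueness of the monic orthogonal polynomials. -/
theorem eq_monicOPUC {μ : Measure Circle} [IsProbabilityMeasure μ]
    (hμ : IsNontrivial μ) {n : ℕ} {P : ℂ[X]} (hP : P.Monic) (hdeg : P.natDegree = n)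
    (horth : ∀ j, j < n → ∫ z : Circle, (starRingEnd ℂ) (z : ℂ) ^ j * P.eval (z : ℂ) ∂μ = 0) :
    P = monicOPUC μ n := by
  by_contra hne
  have hD : (P - monicOPUC μ n).degree < (n : ℕ) := by
    have h := degree_sub_lt_left (p := P) (q := monicOPUC μ n)
      (by rw [degree_eq_natDegree hP.ne_zero, hdeg,
        degree_eq_natDegree (monicOPUC_monic μ n).ne_zero, natDegree_monicOPUC])
      hP.ne_zero (by rw [hP.leadingCoeff, (monicOPUC_monic μ n).leadingCoeff])
    rwa [degree_eq_natDegree hP.ne_zero, hdeg] at h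
  have h1 : ∀ j, j < n → innerProd μ (P - monicOPUC μ n) (X ^ j) = 0 := by
    intro j hj
    rw [← innerProd_conj, innerProd_sub]
    have e1 : innerProd μ (X ^ j) P = 0 := by simpa [innerProd] using horth j hj
    have e2 : innerProd μ (X ^ j) (monicOPUC μ n) = 0 := by
      simpa [innerProd] using integral_monicOPUC hμ hj
    simp [e1, e2]
  refine innerProd_self_ne_zero hμ (sub_ne_zero.2 hne) ?_
  have hsum : ∀ Q : ℂ[X], Q.degree < (n : ℕ) → innerProd μ (P - monicOPUC μ n) Q = 0 := by
    intro Q hQ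
    rw [Q.as_sum_range_C_mul_X_pow' (n := n)
      (by
        rcases eq_or_ne Q 0 with rfl | hQ0
        · rcases Nat.eq_zero_or_pos n with rfl | hn
          · simp at hD
            exact absurd hD (sub_ne_zero.2 hne)
          · simpa using hn
        · exact (natDegree_lt_iff_degree_lt hQ0).2 hQ), innerProd_sum]
    refine Finset.sum_eq_zero fun j hj => ?_
    rw [innerProd_C_mul, h1 j (Finset.mem_range.1 hj), mul_zero]
  exact hsum _ hD

end

end OPUC

/-! Write `w = τ_n α_n`. The pair `(c_{n+1}, m_{n+1})` determines `w`, because `1 - w = (2m / (1 +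
c²)) (1 + ic)`, and `τ_{n+1} / τ_n = (1 - ic) / (1 + ic)` depends on `c_{n+1}` alone. Since `τ_n ≠
0`, periodicity of `α` reduces to that of `τ` (`verblunsky_add`).

The sign rule makes the factors of `τ` cancel in pairs, so `τ_{2n} = 1` and `τ_{2n+1}` depends only
on `c_{2n+1}`. An even shift preserves parity, hence `τ`.

An odd shift carries the sign rule to every index. Going once around the period then gives `c_n =
-c_n = 0`, so `τ = 1` and `α_n = 1 - 2 m_{n+1}` is real. By the Szegő recursion the orthogonal
polynomials are real, hence so are the moments, and density of trigonometric polynomials gives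
symmetry. -/

namespace OPUC

/-! ### Reversed polynomials and the Szegő recursion -/

theorem circle_mul_conj (z : Circle) : (z : ℂ) * (starRingEnd ℂ) (z : ℂ) = 1 := by
  rw [Complex.mul_conj, Circle.normSq_coe, Complex.ofReal_one]

/-- Evaluation on the unit circle of the reversed polynomial `z ^ N * conj (P (1 / conj z))`. -/
theorem eval_reflect_map_conj {P : ℂ[X]} {N : ℕ} (hP : P.natDegree ≤ N) (z : Circle) :
    (reflect N (P.map (starRingEnd ℂ))).eval (z : ℂ) =
      (z : ℂ) ^ N * (starRingEnd ℂ) (P.eval (z : ℂ)) := by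
  have hz := circle_mul_conj z
  let _ : Invertible ((starRingEnd ℂ) (z : ℂ)) := ⟨z, hz, by rw [mul_comm]; exact hz⟩
  have h := eval₂_reflect_mul_pow (RingHom.id ℂ) ((starRingEnd ℂ) (z : ℂ)) N
    (P.map (starRingEnd ℂ)) ((natDegree_map_le).trans hP)
  have h' : (reflect N (P.map (starRingEnd ℂ))).eval (z : ℂ) * (starRingEnd ℂ) (z : ℂ) ^ N =
      (P.map (starRingEnd ℂ)).eval ((starRingEnd ℂ) (z : ℂ)) := h
  rw [eval_map, eval₂_hom] at h'
  rw [← h', mul_comm, mul_assoc, ← mul_pow, mul_comm _ (z : ℂ), hz, one_pow, mul_one]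

/-- A polynomial of degree `≤ n` orthogonal to `1, z, …, z ^ (n - 1)` is a multiple of
`monicOPUC μ n`. -/
theorem eq_C_mul_monicOPUC {μ : Measure Circle} [IsProbabilityMeasure μ]
    (hμ : IsNontrivial μ) {n : ℕ} {S : ℂ[X]} (hdeg : S.natDegree ≤ n)
    (horth : ∀ j, j < n → innerProd μ (X ^ j) S = 0) :
    S = C (S.coeff n) * monicOPUC μ n := by
  have hc : (monicOPUC μ n).coeff n = 1 := by
    have h := (monicOPUC_monic μ n).coeff_natDegree
    rwa [natDegree_monicOPUC] at h
  -- Adding a multiple of `φ_n` makes the polynomial monic without dividing by `S.coeff n`, which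
  -- may vanish.
  have hd : (S + C (1 - S.coeff n) * monicOPUC μ n).natDegree ≤ n :=
    natDegree_add_le_of_degree_le hdeg
      ((natDegree_C_mul_le _ _).trans (natDegree_monicOPUC μ n).le)
  have hcoeff : (S + C (1 - S.coeff n) * monicOPUC μ n).coeff n = 1 := by
    rw [coeff_add, coeff_C_mul, hc]; ring
  have h := eq_monicOPUC hμ (monic_of_natDegree_le_of_coeff_eq_one n hd hcoeff)
    (natDegree_eq_of_le_of_coeff_ne_zero hd (by rw [hcoeff]; exact one_ne_zero)) (by
      intro j hj
      have e1 := horth j hj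
      have e2 : innerProd μ (X ^ j) (monicOPUC μ n) = 0 := by
        simpa [innerProd] using integral_monicOPUC hμ hj
      have e3 : innerProd μ (X ^ j) (S - C (S.coeff n - 1) * monicOPUC μ n) = 0 := by
        rw [innerProd_sub, innerProd_C_mul, e1, e2]; simp
      have e4 : S + C (1 - S.coeff n) * monicOPUC μ n =
          S - C (S.coeff n - 1) * monicOPUC μ n := by
        simp only [C_sub]; ring
      rw [e4]
      simpa [innerProd] using e3)
  simp only [C_sub, C_1] at h
  linear_combination h

/-- Szegő recursion for the monic orthogonal polynomials. -/
theorem monicOPUC_succ {μ : Measure Circle} [IsProbabilityMeasure μ]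
    (hμ : IsNontrivial μ) (n : ℕ) :
    monicOPUC μ (n + 1) = X * monicOPUC μ n - C ((starRingEnd ℂ) (verblunsky μ n)) *
      reflect n ((monicOPUC μ n).map (starRingEnd ℂ)) := by
  set R := monicOPUC μ (n + 1) - X * monicOPUC μ n with hR
  have hRdeg : R.natDegree ≤ n := by
    rw [natDegree_le_iff_coeff_eq_zero]
    intro i hi
    obtain ⟨k, rfl⟩ : ∃ k, i = k + 1 := ⟨i - 1, by omega⟩
    rw [hR, coeff_sub, coeff_X_mul]
    rcases (show n ≤ k by omega).eq_or_lt with rfl | h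
    · have h1 := (monicOPUC_monic μ (n + 1)).coeff_natDegree
      have h2 := (monicOPUC_monic μ n).coeff_natDegree
      rw [natDegree_monicOPUC] at h1 h2
      rw [h1, h2, sub_self]
    · rw [coeff_eq_zero_of_natDegree_lt (by rw [natDegree_monicOPUC]; omega),
        coeff_eq_zero_of_natDegree_lt (by rw [natDegree_monicOPUC]; omega), sub_self]
  -- On the circle `S = z ^ n * conj R`, so orthogonality of `R` to `z, …, z ^ n` becomes
  -- orthogonality of `S` to `1, …, z ^ (n - 1)`.
  set S := reflect n (R.map (starRingEnd ℂ)) with hS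
  have hSdeg : S.natDegree ≤ n :=
    natDegree_reflect_le.trans (max_le le_rfl (natDegree_map_le.trans hRdeg))
  have horth : ∀ j, j < n → innerProd μ (X ^ j) S = 0 := by
    intro j hj
    have key : innerProd μ (X ^ j) S =
        (starRingEnd ℂ) (innerProd μ (X ^ (n - j)) R) := by
      rw [innerProd_conj]
      unfold innerProd
      congr 1
      ext z
      rw [hS, eval_reflect_map_conj hRdeg]
      simp only [eval_pow, eval_X]
      obtain ⟨k, rfl⟩ := Nat.exists_eq_add_of_le hj.le
      rw [Nat.add_sub_cancel_left, map_pow, pow_add]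
      have hz : (starRingEnd ℂ) (z : ℂ) ^ j * (z : ℂ) ^ j = 1 := by
        rw [← mul_pow, mul_comm, circle_mul_conj, one_pow]
      linear_combination ((z : ℂ) ^ k * (starRingEnd ℂ) (R.eval (z : ℂ))) * hz
    have e1 : innerProd μ (X ^ (n - j)) (monicOPUC μ (n + 1)) = 0 := by
      simpa [innerProd] using integral_monicOPUC hμ (show n - j < n + 1 by omega)
    -- Multiplication by `z` preserves the inner product, so one factor `z` cancels on both sides.
    have e2 : innerProd μ (X ^ (n - j)) (X * monicOPUC μ n) = 0 := by
      have h := integral_monicOPUC hμ (show n - j - 1 < n by omega)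
      rw [← h]
      unfold innerProd
      congr 1
      ext z
      obtain ⟨k, hk⟩ : ∃ k, n - j = k + 1 := ⟨n - j - 1, by omega⟩
      rw [hk, Nat.add_sub_cancel]
      simp only [eval_pow, eval_X, eval_mul, pow_succ, map_mul, map_pow]
      linear_combination ((starRingEnd ℂ) (z : ℂ) ^ k * (monicOPUC μ n).eval (z : ℂ)) *
        circle_mul_conj z
    rw [key, hR, innerProd_sub, e1, e2, sub_zero, map_zero]
  have hSeq := eq_C_mul_monicOPUC hμ hSdeg horth
  have hSn : S.coeff n = -verblunsky μ n := by
    rw [hS, coeff_reflect, revAt_le le_rfl, Nat.sub_self, coeff_map, hR, coeff_sub,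
      coeff_zero_eq_eval_zero, verblunsky]
    simp
  have hback : R = reflect n (S.map (starRingEnd ℂ)) := by
    ext i
    simp [hS, coeff_reflect]
  have hfin : R = C (-(starRingEnd ℂ) (verblunsky μ n)) *
      reflect n ((monicOPUC μ n).map (starRingEnd ℂ)) := by
    rw [hback, hSeq, Polynomial.map_mul, map_C, reflect_C_mul, hSn, map_neg]
  rw [C_neg] at hfin
  linear_combination hfin

/-! ### Real coefficients, real moments and symmetry -/

/-- Real Verblunsky coefficients give real orthogonal polynomials. -/
theorem map_conj_monicOPUC {μ : Measure Circle} [IsProbabilityMeasure μ]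
    (hμ : IsNontrivial μ) (hα : ∀ n, (starRingEnd ℂ) (verblunsky μ n) = verblunsky μ n) (n : ℕ) :
    (monicOPUC μ n).map (starRingEnd ℂ) = monicOPUC μ n := by
  induction n with
  | zero =>
    rw [eq_one_of_monic_natDegree_zero (monicOPUC_monic μ 0) (natDegree_monicOPUC μ 0),
      Polynomial.map_one]
  | succ n ih =>
    rw [monicOPUC_succ hμ n]
    simp only [Polynomial.map_sub, Polynomial.map_mul, map_X, map_C, ← reflect_map, ih, hα]

theorem integrable_of_continuous_circle (μ : Measure Circle) [IsFiniteMeasure μ] {f : Circle → ℂ}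
    (hf : Continuous f) : Integrable f μ :=
  hf.integrable_of_hasCompactSupport (HasCompactSupport.of_compactSpace _)

/-- If the orthogonal polynomials have real coefficients, so are the moments of the measure. -/
theorem conj_moment {μ : Measure Circle} [IsProbabilityMeasure μ] (hμ : IsNontrivial μ)
    (hφ : ∀ n, (monicOPUC μ n).map (starRingEnd ℂ) = monicOPUC μ n) (n : ℕ) :
    (starRingEnd ℂ) (∫ z : Circle, (z : ℂ) ^ n ∂μ) = ∫ z : Circle, (z : ℂ) ^ n ∂μ := by
  induction n using Nat.strong_induction_on with
  | _ n ih =>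
    rcases Nat.eq_zero_or_pos n with rfl | hn
    · simp
    -- Orthogonality to `1` expresses the `n`-th moment through lower ones, with real coefficients.
    have h := integral_monicOPUC hμ hn
    have hlead : (monicOPUC μ n).coeff n = 1 := by
      have h := (monicOPUC_monic μ n).coeff_natDegree
      rwa [natDegree_monicOPUC] at h
    simp only [pow_zero, one_mul, eval_eq_sum_range, natDegree_monicOPUC] at h
    rw [integral_finsetSum _ fun i _ => integrable_of_continuous_circle μ (by fun_prop),
      Finset.sum_range_succ, hlead] at h
    simp only [integral_const_mul, one_mul] at h
    rw [eq_neg_of_add_eq_zero_right h, map_neg, map_sum]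
    congr 1
    refine Finset.sum_congr rfl fun i hi => ?_
    rw [map_mul, ih i (Finset.mem_range.1 hi), ← coeff_map, hφ]

/-- Common powers cancel by `z * conj z = 1`, leaving a moment on one side and its conjugate on the
other. -/
theorem integral_conj_pow_mul_pow_symm {μ : Measure Circle}
    (h : ∀ n : ℕ, (starRingEnd ℂ) (∫ z : Circle, (z : ℂ) ^ n ∂μ) = ∫ z : Circle, (z : ℂ) ^ n ∂μ)
    (n k : ℕ) :
    ∫ z : Circle, (z : ℂ) ^ n * (starRingEnd ℂ) (z : ℂ) ^ k ∂μ =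
      ∫ z : Circle, (starRingEnd ℂ) (z : ℂ) ^ n * (z : ℂ) ^ k ∂μ := by
  have hz (z : Circle) (j : ℕ) : (z : ℂ) ^ j * (starRingEnd ℂ) (z : ℂ) ^ j = 1 := by
    rw [← mul_pow, circle_mul_conj, one_pow]
  have h' (j : ℕ) : ∫ z : Circle, (starRingEnd ℂ) (z : ℂ) ^ j ∂μ =
      ∫ z : Circle, (z : ℂ) ^ j ∂μ := by
    rw [← h j, ← integral_conj]; simp only [map_pow]
  rcases le_total n k with hnk | hnk
  · obtain ⟨j, rfl⟩ := Nat.exists_eq_add_of_le hnk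
    convert h' j using 2 <;> ext z
    · linear_combination (starRingEnd ℂ) (z : ℂ) ^ j * hz z n
    · linear_combination (z : ℂ) ^ j * hz z n
  · obtain ⟨j, rfl⟩ := Nat.exists_eq_add_of_le hnk
    convert (h' j).symm using 2 <;> ext z
    · linear_combination (z : ℂ) ^ j * hz z k
    · linear_combination (starRingEnd ℂ) (z : ℂ) ^ j * hz z k

open scoped BoundedContinuousFunction in
/-- The trigonometric polynomials, as a star subalgebra of the continuous functions. -/
def trigPoly : StarSubalgebra ℂ (Circle →ᵇ ℂ) where
  carrier := {f | ∃ (n : ℕ) (P : ℂ[X]), ∀ z : Circle, (z : ℂ) ^ n * f z = P.eval (z : ℂ)}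
  mul_mem' := by
    rintro f g ⟨n, P, hP⟩ ⟨k, Q, hQ⟩
    refine ⟨n + k, P * Q, fun z => ?_⟩
    rw [eval_mul, ← hP, ← hQ, BoundedContinuousFunction.mul_apply]
    ring
  add_mem' := by
    rintro f g ⟨n, P, hP⟩ ⟨k, Q, hQ⟩
    refine ⟨n + k, X ^ k * P + X ^ n * Q, fun z => ?_⟩
    rw [eval_add, eval_mul, eval_mul, ← hP, ← hQ, BoundedContinuousFunction.add_apply]
    simp only [eval_pow, eval_X]
    ring
  algebraMap_mem' := fun a => ⟨0, C a, fun z => by simp⟩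
  star_mem' := by
    rintro f ⟨n, P, hP⟩
    refine ⟨P.natDegree, X ^ n * reflect P.natDegree (P.map (starRingEnd ℂ)), fun z => ?_⟩
    rw [eval_mul, eval_reflect_map_conj le_rfl, ← hP]
    simp only [eval_pow, eval_X, map_mul, map_pow, BoundedContinuousFunction.star_apply,
      RCLike.star_def]
    have hz : (z : ℂ) ^ n * (starRingEnd ℂ) (z : ℂ) ^ n = 1 := by
      rw [← mul_pow, circle_mul_conj, one_pow]
    linear_combination (-(z : ℂ) ^ P.natDegree * (starRingEnd ℂ) (f z)) * hz

theorem separatesPoints_trigPoly :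
    (trigPoly.map (BoundedContinuousFunction.toContinuousMapStarₐ ℂ)).SeparatesPoints := by
  intro x y hxy
  let f : BoundedContinuousFunction Circle ℂ :=
    BoundedContinuousFunction.mkOfCompact ⟨fun z : Circle => (z : ℂ), continuous_subtype_val⟩
  refine ⟨_, ⟨BoundedContinuousFunction.toContinuousMapStarₐ ℂ f,
    ⟨f, ⟨0, X, fun z => (by simp : (z : ℂ) ^ 0 * (z : ℂ) = X.eval (z : ℂ))⟩, rfl⟩, rfl⟩, ?_⟩
  exact fun h => hxy (Subtype.ext h)

/-- A probability measure on the circle with real moments is symmetric. -/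
theorem isSymmetric_of_conj_moment {μ : Measure Circle} [IsProbabilityMeasure μ]
    (h : ∀ n : ℕ,
      (starRingEnd ℂ) (∫ z : Circle, (z : ℂ) ^ n ∂μ) = ∫ z : Circle, (z : ℂ) ^ n ∂μ) :
    IsSymmetric μ := by
  have hinv : Measurable fun z : Circle => z⁻¹ := continuous_inv.measurable
  have : IsFiniteMeasure (μ.map fun z : Circle => z⁻¹) := inferInstance
  -- Finite measures that agree on a point-separating star subalgebra coincide.
  refine ext_of_forall_mem_subalgebra_integral_eq_of_pseudoEMetric_complete_countable
    separatesPoints_trigPoly ?_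
  rintro f ⟨n, P, hP⟩
  rw [integral_map hinv.aemeasurable f.continuous.aestronglyMeasurable]
  have hf (z : Circle) : f z = (starRingEnd ℂ) (z : ℂ) ^ n * P.eval (z : ℂ) := by
    rw [← hP, ← mul_assoc, ← mul_pow, mul_comm _ (z : ℂ), circle_mul_conj, one_pow, one_mul]
  simp only [hf, Circle.coe_inv_eq_conj, Complex.conj_conj, eval_eq_sum_range, Finset.mul_sum]
  rw [integral_finsetSum _ fun i _ => integrable_of_continuous_circle μ (by fun_prop),
    integral_finsetSum _ fun i _ => integrable_of_continuous_circle μ (by fun_prop)]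
  refine Finset.sum_congr rfl fun i _ => ?_
  simp only [mul_left_comm _ (P.coeff i), integral_const_mul]
  rw [integral_conj_pow_mul_pow_symm h]

theorem isSymmetric_of_conj_verblunsky {μ : Measure Circle} [IsProbabilityMeasure μ]
    (hμ : IsNontrivial μ) (hα : ∀ n, (starRingEnd ℂ) (verblunsky μ n) = verblunsky μ n) :
    IsSymmetric μ :=
  isSymmetric_of_conj_moment (conj_moment hμ (map_conj_monicOPUC hμ hα))

/-! ### Recovering `α` and `τ` from the parameters -/

/-- The relation `m_n = d_n / (1 - m_{n-1})` propagates `m_0 = 0`. This identifies the given `m`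
with the one hidden in `IsAssociatedPair`. -/
theorem IsMinimalParameterSeq.unique {d m m' : ℕ → ℝ} (h : IsMinimalParameterSeq d m)
    (h' : IsMinimalParameterSeq d m') : m = m' := by
  ext n
  induction n with
  | zero => rw [h.zero_eq, h'.zero_eq]
  | succ n ih =>
    have e := h.eq_mul (n + 1) (by omega)
    have e' := h'.eq_mul (n + 1) (by omega)
    rw [Nat.add_sub_cancel] at e e'
    rw [e, ih] at e'
    have hlt : m' n < 1 := by
      rcases Nat.eq_zero_or_pos n with rfl | hn
      · exact h'.zero_lt_one
      · exact h'.lt_one n hn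
    exact mul_left_cancel₀ (sub_pos.2 hlt).ne' e'

/-- A complex number `w` is recovered from the data
`c = -Im w / (1 - Re w)` and `m = |1 - w| ^ 2 / (2 (1 - Re w)) ≠ 0`. -/
theorem one_sub_eq_of_params {w : ℂ} {c m : ℝ} (hm0 : m ≠ 0) (hc : c = -w.im / (1 - w.re))
    (hm : m = 1 / 2 * (‖1 - w‖ ^ 2 / (1 - w.re))) :
    1 - w = ((2 * m / (1 + c ^ 2) : ℝ) : ℂ) * (1 + c * Complex.I) := by
  -- Division by zero yields zero, so `1 - w.re = 0` would force `m = 0`.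
  have hr : 1 - w.re ≠ 0 := by
    intro h
    rw [h, div_zero, mul_zero] at hm
    exact hm0 hm
  have him : w.im = -c * (1 - w.re) := by rw [hc]; field_simp
  have hnorm : ‖1 - w‖ ^ 2 = (1 - w.re) ^ 2 * (1 + c ^ 2) := by
    rw [Complex.sq_norm, Complex.normSq_apply]
    simp only [Complex.sub_re, Complex.one_re, Complex.sub_im, Complex.one_im, him]
    ring
  have hre : 2 * m / (1 + c ^ 2) = 1 - w.re := by
    have hc2 : 1 + c ^ 2 ≠ 0 := by positivity
    rw [hm, hnorm]
    field_simp
  rw [hre]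
  apply Complex.ext <;> simp [him]
  ring

theorem one_add_mul_I_ne_zero (c : ℝ) : (1 : ℂ) + c * Complex.I ≠ 0 := by
  intro h
  simpa using congrArg Complex.re h

/-- The numerator in the definition of `tau` is the conjugate of the denominator, so the real factor
`r` cancels. -/
theorem tau_succ_of_params {α : ℕ → ℂ} {n : ℕ} {r c : ℝ} (hr : r ≠ 0)
    (h : 1 - tau α n * α n = (r : ℂ) * (1 + c * Complex.I)) :
    tau α (n + 1) = tau α n * ((1 + (-c : ℝ) * Complex.I) / (1 + c * Complex.I)) := by
  have h' : 1 - (starRingEnd ℂ) (tau α n) * (starRingEnd ℂ) (α n) =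
      (r : ℂ) * (1 + (-c : ℝ) * Complex.I) := by
    have := congrArg (starRingEnd ℂ) h
    simpa using this
  rw [tau, h, h', mul_div_mul_left _ _ (Complex.ofReal_ne_zero.2 hr)]

section Pair

variable {μ : Measure Circle} {c d m : ℕ → ℝ}

theorem IsAssociatedPair.one_sub_eq (hcd : IsAssociatedPair μ c d)
    (hm : IsMinimalParameterSeq d m) (n : ℕ) :
    1 - tau (verblunsky μ) n * verblunsky μ n =
      ((2 * m (n + 1) / (1 + c (n + 1) ^ 2) : ℝ) : ℂ) * (1 + c (n + 1) * Complex.I) := by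
  obtain ⟨m', hm', h⟩ := hcd
  obtain rfl := hm.unique hm'
  obtain ⟨hc, hmn⟩ := h (n + 1) (by omega)
  exact one_sub_eq_of_params (hm.pos (n + 1) (by omega)).ne' hc hmn

theorem IsAssociatedPair.tau_succ (hcd : IsAssociatedPair μ c d)
    (hm : IsMinimalParameterSeq d m) (n : ℕ) :
    tau (verblunsky μ) (n + 1) = tau (verblunsky μ) n *
      ((1 + (-c (n + 1) : ℝ) * Complex.I) / (1 + c (n + 1) * Complex.I)) := by
  refine tau_succ_of_params ?_ (hcd.one_sub_eq hm n)
  have := hm.pos (n + 1) (by omega)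
  positivity

theorem IsAssociatedPair.tau_even (hcd : IsAssociatedPair μ c d)
    (hm : IsMinimalParameterSeq d m) (hc_alt : ∀ n, 1 ≤ n → c (2 * n) = -c (2 * n - 1)) (n : ℕ) :
    tau (verblunsky μ) (2 * n) = 1 := by
  induction n with
  | zero => rfl
  | succ n ih =>
    have h := hc_alt (n + 1) (by omega)
    rw [show 2 * (n + 1) - 1 = 2 * n + 1 by omega] at h
    rw [show 2 * (n + 1) = 2 * n + 1 + 1 by ring] at h ⊢
    rw [hcd.tau_succ hm, hcd.tau_succ hm, ih, h, neg_neg]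
    have h1 := one_add_mul_I_ne_zero (c (2 * n + 1))
    have h2 := one_add_mul_I_ne_zero (-c (2 * n + 1))
    rw [one_mul, div_mul_div_cancel₀ h1, div_self h2]

theorem IsAssociatedPair.tau_ne_zero (hcd : IsAssociatedPair μ c d)
    (hm : IsMinimalParameterSeq d m) (n : ℕ) : tau (verblunsky μ) n ≠ 0 := by
  induction n with
  | zero => exact one_ne_zero
  | succ n ih =>
    rw [hcd.tau_succ hm]
    exact mul_ne_zero ih (div_ne_zero (one_add_mul_I_ne_zero _) (one_add_mul_I_ne_zero _))

theorem IsAssociatedPair.verblunsky_add (hcd : IsAssociatedPair μ c d)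
    (hm : IsMinimalParameterSeq d m) {p : ℕ} (hc_per : ∀ n, 1 ≤ n → c (n + p) = c n)
    (hm_per : ∀ n, 1 ≤ n → m (n + p) = m n) {n : ℕ}
    (hτ : tau (verblunsky μ) (n + p) = tau (verblunsky μ) n) :
    verblunsky μ (n + p) = verblunsky μ n := by
  have h1 := hcd.one_sub_eq hm n
  have h2 := hcd.one_sub_eq hm (n + p)
  rw [show n + p + 1 = n + 1 + p by ring, hc_per _ (by omega), hm_per _ (by omega), hτ, ← h1] at h2
  exact mul_left_cancel₀ (hcd.tau_ne_zero hm n) (sub_right_injective h2)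

/-- An odd period and sign alternation force `c` to vanish. -/
theorem eq_zero_of_odd_period {p : ℕ} (hp : Odd p) (hc_per : ∀ n, 1 ≤ n → c (n + p) = c n)
    (hc_alt : ∀ n, 1 ≤ n → c (2 * n) = -c (2 * n - 1)) (n : ℕ) (hn : 1 ≤ n) : c n = 0 := by
  have hodd : ∀ n, Odd n → c (n + 1) = -c n := by
    rintro n ⟨k, rfl⟩
    have h := hc_alt (k + 1) (by omega)
    rwa [show 2 * (k + 1) - 1 = 2 * k + 1 by omega] at h
  have hsucc : ∀ n, 1 ≤ n → c (n + 1) = -c n := by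
    intro n hn
    rcases Nat.even_or_odd n with h | h
    -- For even `n`, the index `n + p` is odd; periodicity brings the sign rule back to `n`.
    · have := hodd (n + p) (h.add_odd hp)
      rwa [show n + p + 1 = n + 1 + p by ring, hc_per _ (by omega), hc_per _ hn] at this
    · exact hodd n h
  have hpow : ∀ k, c (n + k) = (-1) ^ k * c n := by
    intro k
    induction k with
    | zero => simp
    | succ k ih => rw [← add_assoc, hsucc _ (by omega), ih, pow_succ]; ring
  have h := hpow p
  rw [hc_per n hn, hp.neg_one_pow] at h
  linarith

end Pair

end OPUC

theorem mainTheorem3 (μ : MeasureTheory.Measure Circle) [MeasureTheory.IsProbabilityMeasure μ]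
    (hμ : OPUC.IsNontrivial μ)
    (c d m : ℕ → ℝ)
    (hd : OPUC.IsPositiveChainSeq d)
    (hm : OPUC.IsMinimalParameterSeq d m)
    (hcd : OPUC.IsAssociatedPair μ c d)
    (p : ℕ) (hp : 1 ≤ p)
    (hc_per : ∀ n, 1 ≤ n → c (n + p) = c n)
    (hm_per : ∀ n, 1 ≤ n → m (n + p) = m n)
    (hc_alt : ∀ n, 1 ≤ n → c (2 * n) = -c (2 * n - 1)) :
    (Even p → ∀ n, OPUC.verblunsky μ (n + p) = OPUC.verblunsky μ n) ∧
    (Odd p → OPUC.IsSymmetric μ ∧ (∀ n, 1 ≤ n → c n = 0) ∧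
      ∀ n, OPUC.verblunsky μ (n + p) = OPUC.verblunsky μ n) := by
  refine ⟨fun hpe n => ?_, fun hpo => ?_⟩
  · refine hcd.verblunsky_add hm hc_per hm_per ?_
    obtain ⟨q, rfl⟩ := hpe.two_dvd
    rcases Nat.even_or_odd' n with ⟨k, rfl | rfl⟩
    · rw [← mul_add, hcd.tau_even hm hc_alt, hcd.tau_even hm hc_alt]
    -- At an odd index `τ` is a single factor in `c`, because the preceding even `τ` is `1`.
    · rw [show 2 * k + 1 + 2 * q = 2 * (k + q) + 1 by ring, hcd.tau_succ hm, hcd.tau_succ hm,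
        hcd.tau_even hm hc_alt, hcd.tau_even hm hc_alt,
        show 2 * (k + q) + 1 = 2 * k + 1 + 2 * q by ring, hc_per _ (by omega)]
  · have hc0 := OPUC.eq_zero_of_odd_period hpo hc_per hc_alt
    have hτ : ∀ n, OPUC.tau (OPUC.verblunsky μ) n = 1 := by
      intro n
      induction n with
      | zero => rfl
      | succ n ih => rw [hcd.tau_succ hm, ih, hc0 _ (by omega)]; simp
    refine ⟨OPUC.isSymmetric_of_conj_verblunsky hμ fun n => ?_, hc0, fun n =>
      hcd.verblunsky_add hm hc_per hm_per (by rw [hτ, hτ])⟩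
    have h := hcd.one_sub_eq hm n
    rw [hτ, one_mul, hc0 _ (by omega), sub_eq_iff_eq_add, ← sub_eq_iff_eq_add'] at h
    rw [← h, Complex.ofReal_zero, zero_mul, add_zero, mul_one, map_sub, map_one, Complex.conj_ofReal]
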